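/- Let $k$ be a field of characteristic $p>0$ and let $G$ be a finite group scheme over $k$, that is, an affine group scheme whose coordinate algebra $k[G]$ is finite dimensional over $k$. Let $kG=\operatorname{Hom}_k(k[G],k)$ be its group algebra; $G$-modules are identified with left $kG$-modules. A *$\pi$-point* of $G$ defined over $k$ is a homomorphism of $k$-algebras $\alpha\colon k[t]/(t^p)\to kG$ that factors through the group algebra $kU\to kG$ of a unipotent abelian subgroup scheme $U$ of $G$, and such that $kG$ is flat as a left $k[t]/(t^p)$-module via $\alpha$. **Theorem.** For any $\pi$-point $\alpha\colon k[t]/(t^p)\to kG$ and any (not necessarily finite dimensional) $k[t]/(t^p)$-module $M$ there is an isomorphism of $G$-modules, natural in $M$, $$kG\otimes_{k[t]/(t^p)}M\;\cong\;\operatorname{Hom}_{k[t]/(t^p)}(kG,M).$$ Here, on the left, $kG$ is a right $k[t]/(t^p)$-module via $\alpha$ and $kG$ acts by left multiplication; on the right, $kG$ is a left $k[t]/(t^p)$-module via $\alpha$ and $kG$ acts by $(a\cdot f)(x)=f(xa)$. In other words, the left adjoint and the right adjoint of the restriction functor $\alpha^*\colon\operatorname{Mod}G\to\operatorname{Mod}k[t]/(t^p)$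 are naturally isomorphic. -/

import Mathlib

open CategoryTheory
open scoped TensorProduct

universe u v w

noncomputable section

namespace PiPoint

/-! An affine group scheme `G` over `k` is given by its coordinate algebra `A = k[G]`, a commutative
Hopf algebra over `k`; it is finite when `A` is finite-dimensional. -/

/-- The group algebra `kG` of the group scheme `G` with coordinate algebra `A = k[G]`: the `k`-linear
dual of `A`, with the convolution product `(f * g)(a) = ∑ f(a₁) g(a₂)` and unit the counit of `A`. -/
abbrev GroupAlg (k : Type u) (A : Type v) [Field k] [CommRing A] [HopfAlgebra k A] : Type (max u v) :=
  WithConv (A →ₗ[k] k)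

/-- The map of group algebras `kU → kG` induced by a homomorphism of group schemes `U → G`, where
`φ : k[G] → k[U]` is the corresponding homomorphism of Hopf algebras. It is precomposition with `φ`. -/
def GroupAlg.map {k : Type u} {A B : Type v} [Field k] [CommRing A] [HopfAlgebra k A]
    [CommRing B] [HopfAlgebra k B] (φ : A →ₐc[k] B) : GroupAlg k B →ₐ[k] GroupAlg k A :=
  AlgHom.ofLinearMap
    { toFun := fun f => WithConv.toConv (f.ofConv.comp (φ : A →ₗc[k] B).toLinearMap)
      map_add' := fun _ _ => rfl
      map_smul' := fun _ _ => rfl }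
    (by
      ext a
      exact CoalgHomClass.counit_comp_apply φ a)
    (fun f g => by
      ext a
      exact LinearMap.congr_fun
        (LinearMap.convMul_comp_coalgHom_distrib f g (φ : A →ₗc[k] B)) a)

/-- The group scheme `U` with coordinate algebra `B = k[U]` is unipotent: every nonzero `U`-module `V`
(that is, `kU`-module) has a nonzero fixed vector, i.e. one on which `kU` acts through its
augmentation `kU → k`, `f ↦ f 1`. -/
def IsUnipotent (k : Type u) (B : Type v) [Field k] [CommRing B] [HopfAlgebra k B] : Prop :=
  ∀ (V : Type u) [AddCommGroup V] [Module (GroupAlg k B) V] [Nontrivial V],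
    ∃ x : V, x ≠ 0 ∧
      ∀ f : GroupAlg k B, f • x = algebraMap k (GroupAlg k B) (f.ofConv 1) • x

/-- The truncated polynomial algebra `k[t]/(t^p)`. -/
abbrev TruncPoly (k : Type u) [Field k] (p : ℕ) : Type u :=
  Polynomial k ⧸ Ideal.span {(Polynomial.X : Polynomial k) ^ p}

/-- `α : k[t]/(t^p) → kG` is a `π`-point (defined over `k`) of the group scheme `G` with coordinate
algebra `A = k[G]`: it factors through the group algebra of a unipotent abelian (closed) subgroup scheme
`U` of `G`, and `kG` is flat as a left `k[t]/(t^p)`-module via `α`.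
A closed subgroup scheme is a surjection of commutative Hopf algebras `φ : k[G] → k[U]`, and `U` is
abelian if and only if `k[U]` is cocommutative. -/
structure IsPiPoint {k : Type u} {A : Type v} [Field k] [CommRing A] [HopfAlgebra k A] {p : ℕ}
    (α : TruncPoly k p →ₐ[k] GroupAlg k A) : Prop where
  factors : ∃ (B : Type v) (_ : CommRing B) (_ : HopfAlgebra k B) (φ : A →ₐc[k] B)
    (β : TruncPoly k p →ₐ[k] GroupAlg k B),
      Function.Surjective φ ∧ Coalgebra.IsCocomm k B ∧ IsUnipotent k B ∧
        α = (GroupAlg.map φ).comp β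
  flat : Module.Flat (TruncPoly k p)
    ((ModuleCat.restrictScalars (α : TruncPoly k p →+* GroupAlg k A)).obj
      (ModuleCat.of (GroupAlg k A) (GroupAlg k A)))

section Tensor

variable {R : Type u} {S : Type v} [CommRing R] [Ring S]

/-- The ring `S`, seen as an `S`-`R`-bimodule through a ring homomorphism `f : R → S`: the ring `S` acts
by left multiplication, and `R` by `r • s = s * f r` (since `R` is commutative, this right action is
recorded as a left one). -/
def RightVia (_f : R →+* S) : Type v := S

instance (f : R →+* S) : AddCommGroup (RightVia f) := inferInstanceAs (AddCommGroup S)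

instance (f : R →+* S) : Module S (RightVia f) := inferInstanceAs (Module S S)

instance (f : R →+* S) : Module R (RightVia f) where
  smul r s := (show S from s) * f r
  one_smul s := show (show S from s) * f 1 = s by
    rw [map_one]; exact mul_one (show S from s)
  mul_smul r r' s := show (show S from s) * f (r * r') = (show S from s) * f r' * f r by
    rw [mul_comm r r', map_mul, mul_assoc]
  smul_zero r := show (0 : S) * f r = 0 by simp
  smul_add r s s' := add_mul (show S from s) (show S from s') (f r)
  add_smul r r' s := show (show S from s) * f (r + r') = (show S from s) * f r + (show S from s) * f r' by
    rw [map_add, mul_add]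
  zero_smul s := show (show S from s) * f 0 = (0 : S) by
    rw [map_zero]; exact mul_zero (show S from s)

instance (f : R →+* S) : SMulCommClass R S (RightVia f) where
  smul_comm r s x := mul_assoc s (show S from x) (f r)

/-- The functor `S ⊗_R - : Mod R ⥤ Mod S` along `f : R → S`, for `R` commutative and `S` any ring, where
`S` is a right `R`-module via `f` and acts on `S ⊗_R M` by `s • (x ⊗ m) = (s * x) ⊗ m`. -/
def tensorAlong (f : R →+* S) : ModuleCat.{w} R ⥤ ModuleCat.{max v w} S where
  obj M := ModuleCat.of S (RightVia f ⊗[R] M)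
  map {M N} g := ModuleCat.ofHom
    { toFun := LinearMap.lTensor (RightVia f) g.hom
      map_add' := map_add _
      map_smul' := fun s x => by
        induction x using TensorProduct.induction_on with
        | zero => simp
        | tmul a m => rfl
        | add x y hx hy =>
          simp only [smul_add, map_add, hx, hy] }
  map_id M := by
    ext x
    exact LinearMap.congr_fun (LinearMap.lTensor_id (RightVia f) M) x
  map_comp g h := by
    ext x
    exact LinearMap.congr_fun (LinearMap.lTensor_comp (RightVia f) h.hom g.hom) x

end Tensor

end PiPoint

end

/-!
Write `S = kG`, `R = k[t]/(t^p)` and `A = k[G]`. If `S` carries an `R`-bilinear map `E : S → R` and finite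
families `x`, `a` with `s = ∑ E(s aᵢ) xᵢ = ∑ aᵢ E(xᵢ s)`, then `s ⊗ m ↦ (x ↦ E(x s) m)` is a natural
isomorphism from induction to coinduction (`frobeniusMap_bijective`). Such an `E` comes from Frobenius
forms `σ` on `R` and `τ` on `S` by `σ (r E(s)) = τ (α(r) s)`: it is linear on the left by construction, linear
on the right as soon as `τ (α(r) s) = τ (s α(r))`, and the families exist because `S` is finite and flat,
hence projective, over `R` (`nonempty_iso_of_frobeniusForms`).

The form `σ` is the coefficient of `t^(p-1)`. For `τ`, a nonzero left integral `l` in the dual of `A` is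
constructed as a trace (`isLeftIntegral_traceForm`, `exists_isLeftIntegral_ne_zero`); it is a Frobenius form
on `A` (`eq_zero_of_forall_mul_eq_zero`), so there is `t` in `A` with `l (x t) = ε(x)`, and `τ` is
evaluation at `t`. Every `h` in `kG` has the form `l (a ·)`, and for all `f` in `kG`
`(f * h)(t) = f(S a)` while `(h * f)(t) = f(g S(a))`, where `g = l(t₁) t₂` is the modular element, a group-like
element of `A`. A character of a unipotent group scheme `U` is trivial, so `g` maps to `1` in `k[U]`
(`IsUnipotent.eq_one`), and `τ` commutes with the image of `kU`, through which `α` factors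
(`exists_frobeniusForm`).
-/

noncomputable section

namespace PiPoint

/-! ### The group algebra and the Galois maps -/

section Hopf

open HopfAlgebra Coalgebra

variable {k : Type u} {A : Type v} [Field k] [CommRing A] [HopfAlgebra k A]

/-- The antipode of a commutative Hopf algebra is an involution: it is the inverse of the identity in
the convolution group of algebra endomorphisms, and composing with it once more inverts again. -/
theorem antipode_antipode (a : A) : antipode k (antipode k a) = a := by
  have h := inv_inv (WithConv.toConv (AlgHom.id k A))
  exact DFunLike.congr_fun (congrArg WithConv.ofConv h) a

/-- The map `id ⊗ f : A ⊗ A → A`, `a ⊗ b ↦ f b • a`. -/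
def leftSlice (f : A →ₗ[k] k) : A ⊗[k] A →ₗ[k] A :=
  (TensorProduct.rid k A).toLinearMap ∘ₗ f.lTensor A

@[simp]
theorem leftSlice_tmul (f : A →ₗ[k] k) (a b : A) : leftSlice f (a ⊗ₜ b) = f b • a := by
  simp [leftSlice]

/-- The map `f ⊗ id : A ⊗ A → A`, `a ⊗ b ↦ f a • b`. -/
def rightSlice (f : A →ₗ[k] k) : A ⊗[k] A →ₗ[k] A :=
  (TensorProduct.lid k A).toLinearMap ∘ₗ f.rTensor A

@[simp]
theorem rightSlice_tmul (f : A →ₗ[k] k) (a b : A) : rightSlice f (a ⊗ₜ b) = f a • b := by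
  simp [rightSlice]

theorem convMul_apply_leftSlice (f h : GroupAlg k A) (x : A) :
    (f * h).ofConv x = f.ofConv (leftSlice h.ofConv (comul x)) := by
  change LinearMap.mul' k k (TensorProduct.map f.ofConv h.ofConv (comul x)) = _
  induction comul (R := k) x using TensorProduct.induction_on with
  | zero => simp
  | tmul a b => simp [mul_comm]
  | add y z hy hz => simp only [map_add, hy, hz]

theorem convMul_apply_rightSlice (f h : GroupAlg k A) (x : A) :
    (f * h).ofConv x = h.ofConv (rightSlice f.ofConv (comul x)) := by
  change LinearMap.mul' k k (TensorProduct.map f.ofConv h.ofConv (comul x)) = _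
  induction comul (R := k) x using TensorProduct.induction_on with
  | zero => simp
  | tmul a b => simp
  | add y z hy hz => simp only [map_add, hy, hz]

theorem leftSlice_tmul_one_mul (f : A →ₗ[k] k) (a : A) (z : A ⊗[k] A) :
    leftSlice f ((a ⊗ₜ 1) * z) = a * leftSlice f z := by
  induction z using TensorProduct.induction_on with
  | zero => simp
  | tmul b c => simp
  | add y z hy hz => simp only [map_add, mul_add, hy, hz]

theorem leftSlice_one_tmul_mul (f : A →ₗ[k] k) (a : A) (z : A ⊗[k] A) :
    leftSlice f ((1 ⊗ₜ a) * z) = leftSlice (f ∘ₗ LinearMap.mul k A a) z := by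
  induction z using TensorProduct.induction_on with
  | zero => simp
  | tmul b c => simp
  | add y z hy hz => simp only [map_add, mul_add, hy, hz]

theorem rightSlice_tmul_one_mul (f : A →ₗ[k] k) (a : A) (z : A ⊗[k] A) :
    rightSlice f ((a ⊗ₜ 1) * z) = rightSlice (f ∘ₗ LinearMap.mul k A a) z := by
  induction z using TensorProduct.induction_on with
  | zero => simp
  | tmul b c => simp
  | add y z hy hz => simp only [map_add, mul_add, hy, hz]

theorem rightSlice_mul_one_tmul (f : A →ₗ[k] k) (a : A) (z : A ⊗[k] A) :
    rightSlice f (z * (1 ⊗ₜ a)) = rightSlice f z * a := by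
  induction z using TensorProduct.induction_on with
  | zero => simp
  | tmul b c => simp
  | add y z hy hz => simp only [map_add, add_mul, hy, hz]

theorem leftSlice_rTensor (f : A →ₗ[k] k) (g : A →ₗ[k] A) (z : A ⊗[k] A) :
    leftSlice f (g.rTensor A z) = g (leftSlice f z) := by
  induction z using TensorProduct.induction_on with
  | zero => simp
  | tmul b c => simp
  | add y z hy hz => simp only [map_add, hy, hz]

theorem rightSlice_lTensor (f : A →ₗ[k] k) (g : A →ₗ[k] A) (z : A ⊗[k] A) :
    rightSlice f (g.lTensor A z) = g (rightSlice f z) := by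
  induction z using TensorProduct.induction_on with
  | zero => simp
  | tmul b c => simp
  | add y z hy hz => simp only [map_add, hy, hz]

theorem leftSlice_counit_comul (a : A) : leftSlice (counit (R := k)) (comul a) = a := by
  simp [leftSlice]

theorem rightSlice_counit_comul (a : A) : rightSlice (counit (R := k)) (comul a) = a := by
  simp [rightSlice]

variable (k A) in
/-- The left Galois map `a ⊗ x ↦ a x₁ ⊗ x₂`, linear over the left factor. -/
def leftGalois : A ⊗[k] A →ₐ[A] A ⊗[k] A :=
  Algebra.TensorProduct.lift Algebra.TensorProduct.includeLeft (Bialgebra.comulAlgHom k A)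
    fun _ _ => Commute.all _ _

theorem leftGalois_tmul (a x : A) :
    leftGalois k A (a ⊗ₜ x) = (a ⊗ₜ 1) * comul x := by
  simp [leftGalois]

/-- The right Galois map `x ⊗ a ↦ x₁ ⊗ x₂ a`. -/
def rightGalois (k : Type u) (A : Type v) [Field k] [CommRing A] [HopfAlgebra k A] :
    A ⊗[k] A →ₐ[k] A ⊗[k] A :=
  Algebra.TensorProduct.lift (Bialgebra.comulAlgHom k A) Algebra.TensorProduct.includeRight
    fun _ _ => Commute.all _ _

theorem rightGalois_tmul (x a : A) :
    rightGalois k A (x ⊗ₜ a) = comul x * (1 ⊗ₜ a) := by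
  simp [rightGalois]

/-- In Sweedler notation: `S(x₁) x₂ ⊗ x₃ = 1 ⊗ x`. -/
theorem leftGalois_rTensor_antipode_comul (x : A) :
    leftGalois k A ((antipode k).rTensor A (comul x)) = 1 ⊗ₜ x := by
  let Φ : (A ⊗[k] A) ⊗[k] A →ₗ[k] A ⊗[k] A :=
    (LinearMap.mul' k A ∘ₗ (antipode k).rTensor A).rTensor A
  have hΦ : ∀ a z, Φ ((TensorProduct.assoc k A A A).symm (a ⊗ₜ z)) = (antipode k a ⊗ₜ 1) * z := by
    intro a z
    induction z using TensorProduct.induction_on with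
    | zero => simp
    | tmul b c => simp [Φ]
    | add y z hy hz => simp only [TensorProduct.tmul_add, map_add, mul_add, hy, hz]
  calc leftGalois k A ((antipode k).rTensor A (comul x))
      = Φ ((TensorProduct.assoc k A A A).symm (comul.lTensor A (comul x))) := by
        induction comul (R := k) x using TensorProduct.induction_on with
        | zero => simp
        | tmul a b => simp [leftGalois_tmul, hΦ]
        | add y z hy hz => simp only [map_add, hy, hz]
    _ = (LinearMap.mul' k A ∘ₗ (antipode k).rTensor A ∘ₗ comul).rTensor A (comul x) := by
        rw [coassoc_symm_apply]
        simp only [Φ, LinearMap.rTensor_comp, LinearMap.comp_apply]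
    _ = 1 ⊗ₜ x := by
        rw [HopfAlgebra.mul_antipode_rTensor_comul, LinearMap.rTensor_comp_apply,
          rTensor_counit_comul]
        simp

/-- In Sweedler notation: `x₁ ⊗ x₂ S(x₃) = x ⊗ 1`. -/
theorem rightGalois_lTensor_antipode_comul (x : A) :
    rightGalois k A ((antipode k).lTensor A (comul x)) = x ⊗ₜ 1 := by
  let Φ : A ⊗[k] (A ⊗[k] A) →ₗ[k] A ⊗[k] A :=
    (LinearMap.mul' k A ∘ₗ (antipode k).lTensor A).lTensor A
  have hΦ : ∀ a z, Φ (TensorProduct.assoc k A A A (z ⊗ₜ a)) = z * (1 ⊗ₜ antipode k a) := by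
    intro a z
    induction z using TensorProduct.induction_on with
    | zero => simp
    | tmul b c => simp [Φ]
    | add y z hy hz => simp only [TensorProduct.add_tmul, map_add, add_mul, hy, hz]
  calc rightGalois k A ((antipode k).lTensor A (comul x))
      = Φ (TensorProduct.assoc k A A A (comul.rTensor A (comul x))) := by
        induction comul (R := k) x using TensorProduct.induction_on with
        | zero => simp
        | tmul a b => simp [rightGalois_tmul, hΦ]
        | add y z hy hz => simp only [map_add, hy, hz]
    _ = (LinearMap.mul' k A ∘ₗ (antipode k).lTensor A ∘ₗ comul).lTensor A (comul x) := by
        rw [coassoc_apply]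
        simp only [Φ, LinearMap.lTensor_comp, LinearMap.comp_apply]
    _ = x ⊗ₜ 1 := by
        rw [HopfAlgebra.mul_antipode_lTensor_comul, LinearMap.lTensor_comp_apply,
          lTensor_counit_comul]
        simp

theorem leftGalois_surjective : Function.Surjective (leftGalois k A) := by
  intro z
  induction z using TensorProduct.induction_on with
  | zero => exact ⟨0, map_zero _⟩
  | tmul a b =>
    refine ⟨(a ⊗ₜ 1) * (antipode k).rTensor A (comul b), ?_⟩
    rw [map_mul, leftGalois_rTensor_antipode_comul, leftGalois_tmul]
    simp
  | add y z hy hz =>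
    obtain ⟨y, rfl⟩ := hy
    obtain ⟨z, rfl⟩ := hz
    exact ⟨y + z, map_add _ _ _⟩

theorem exists_repr_basis {ι : Type*} [Fintype ι] (e : Module.Basis ι k A) (z : A ⊗[k] A) :
    ∃ r : ι → A, z = ∑ i, e i ⊗ₜ r i := by
  induction z using TensorProduct.induction_on with
  | zero => exact ⟨0, by simp⟩
  | tmul a b =>
    refine ⟨fun i => e.repr a i • b, ?_⟩
    conv_lhs => rw [← e.sum_repr a, TensorProduct.sum_tmul]
    simp [TensorProduct.smul_tmul]
  | add y z hy hz =>
    obtain ⟨r, rfl⟩ := hy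
    obtain ⟨s, rfl⟩ := hz
    exact ⟨r + s, by simp [TensorProduct.tmul_add, Finset.sum_add_distrib]⟩

/-! ### Integrals in the dual of a finite-dimensional commutative Hopf algebra -/

/-- The operator `x ↦ x₁ f(x₂)` on `A`. -/
def convolve (f : A →ₗ[k] k) : A →ₗ[k] A := leftSlice f ∘ₗ comul

/-- By coassociativity `x ↦ x₁ f(x₂)` is a comodule endomorphism of `A`. -/
theorem comul_convolve (f : A →ₗ[k] k) (x : A) :
    comul (convolve f x) = (convolve f).lTensor A (comul x) := by
  let Ψ : (A ⊗[k] A) ⊗[k] A →ₗ[k] A ⊗[k] A :=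
    (leftSlice f).lTensor A ∘ₗ (TensorProduct.assoc k A A A).toLinearMap
  have hΨ : ∀ z b, Ψ (z ⊗ₜ b) = f b • z := by
    intro z b
    induction z using TensorProduct.induction_on with
    | zero => simp
    | tmul c d => simp [Ψ]
    | add y z hy hz => simp only [TensorProduct.add_tmul, map_add, smul_add, hy, hz]
  calc comul (convolve f x) = Ψ (comul.rTensor A (comul x)) := by
        change comul (leftSlice f (comul x)) = _
        induction comul (R := k) x using TensorProduct.induction_on with
        | zero => simp
        | tmul a b => simp [hΨ]
        | add y z hy hz => simp only [map_add, hy, hz]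
    _ = (leftSlice f).lTensor A (comul.lTensor A (comul x)) := by
        rw [← coassoc_apply]; rfl
    _ = _ := by rw [convolve, LinearMap.lTensor_comp_apply]

theorem leftGalois_baseChange_convolve (f : A →ₗ[k] k) (z : A ⊗[k] A) :
    leftGalois k A ((convolve f).baseChange A z) =
      (convolve f).baseChange A (leftGalois k A z) := by
  induction z using TensorProduct.induction_on with
  | zero => simp
  | tmul a x =>
    rw [LinearMap.baseChange_tmul, leftGalois_tmul, leftGalois_tmul, comul_convolve]
    have h : ∀ y : A ⊗[k] A, (a ⊗ₜ[k] (1 : A)) * y = a • y := fun y => by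
      rw [Algebra.smul_def]; rfl
    rw [h, h, map_smul]; rfl
  | add y z hy hz => simp only [map_add, hy, hz]

/-- A linear form `l` on `A` is a left integral in the dual of `A` if `x₁ l(x₂) = l(x) 1`. -/
def IsLeftIntegral (l : A →ₗ[k] k) : Prop := ∀ x, convolve l x = l x • 1

/-- A left integral in the dual of `A` spans a trivial left submodule of the group algebra. -/
theorem isLeftIntegral_iff {l : A →ₗ[k] k} :
    IsLeftIntegral l ↔ ∀ h : GroupAlg k A, h * WithConv.toConv l = h.ofConv 1 • WithConv.toConv l := by
  constructor
  · intro hl h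
    ext x
    rw [convMul_apply_leftSlice]
    change h.ofConv (convolve l x) = h.ofConv 1 * l x
    rw [hl, map_smul, smul_eq_mul, mul_comm]
  · intro H x
    rw [← sub_eq_zero, ← Module.forall_dual_apply_eq_zero_iff k]
    intro h
    have h1 := congrArg (fun f => f.ofConv x) (H (WithConv.toConv h))
    simp only [convMul_apply_leftSlice] at h1
    rw [map_sub, sub_eq_zero, map_smul]
    refine h1.trans (mul_comm _ _)

theorem leftSlice_leftGalois {l : A →ₗ[k] k} (hl : IsLeftIntegral l) (z : A ⊗[k] A) :
    leftSlice l (leftGalois k A z) = leftSlice l z := by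
  induction z using TensorProduct.induction_on with
  | zero => simp
  | tmul a x =>
    rw [leftGalois_tmul, leftSlice_tmul_one_mul, leftSlice_tmul]
    change a * convolve l x = _
    rw [hl, mul_smul_comm, mul_one]
  | add y z hy hz => simp only [map_add, hy, hz]

/-- In Sweedler notation: `x₁ l(c x₂) = S(c₁) l(c₂ x)` for a left integral `l`. -/
theorem leftSlice_one_tmul_mul_comul {l : A →ₗ[k] k} (hl : IsLeftIntegral l) (c x : A) :
    leftSlice l ((1 ⊗ₜ c) * comul x) =
      leftSlice l ((antipode k).rTensor A (comul c) * (1 ⊗ₜ x)) := by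
  rw [← leftSlice_leftGalois hl ((antipode k).rTensor A (comul c) * _), map_mul (leftGalois k A),
    leftGalois_rTensor_antipode_comul, leftGalois_tmul, ← Algebra.TensorProduct.one_def, one_mul]

/-- In Sweedler notation: `t₁ l(a t₂) = S(a)`. -/
theorem leftSlice_one_tmul_mul_comul_integral {l : A →ₗ[k] k} (hl : IsLeftIntegral l) {t : A}
    (ht : ∀ x, l (x * t) = counit (R := k) x) (a : A) :
    leftSlice l ((1 ⊗ₜ a) * comul t) = antipode k a := by
  have h : ∀ z : A ⊗[k] A, leftSlice l (z * (1 ⊗ₜ t)) = leftSlice counit z := by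
    intro z
    induction z using TensorProduct.induction_on with
    | zero => simp
    | tmul b c => simp [ht]
    | add y z hy hz => simp only [map_add, add_mul, hy, hz]
  rw [leftSlice_one_tmul_mul_comul hl, h, leftSlice_rTensor, leftSlice_counit_comul]

theorem counit_modular {l : A →ₗ[k] k} {t : A}
    (ht : ∀ x, l (x * t) = counit (R := k) x) :
    counit (R := k) (rightSlice l (comul t)) = 1 := by
  rw [show counit (R := k) (rightSlice l (comul t)) = l (leftSlice (counit (R := k)) (comul t)) from ?_,
    leftSlice_counit_comul]
  · simpa using ht 1
  · induction comul (R := k) t using TensorProduct.induction_on with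
    | zero => simp
    | tmul b c => simp [mul_comm]
    | add y z hy hz => simp only [map_add, hy, hz]

theorem IsLeftIntegral.convMul {l : A →ₗ[k] k} (hl : IsLeftIntegral l) (f : GroupAlg k A) :
    IsLeftIntegral (WithConv.toConv l * f).ofConv := by
  rw [isLeftIntegral_iff] at hl ⊢
  intro h
  rw [WithConv.toConv_ofConv, ← mul_assoc, hl, smul_mul_assoc]

/-- The functional `b ↦ tr (x ↦ b x₁ f(x₂))`. -/
def traceForm (f : A →ₗ[k] k) : A →ₗ[k] k :=
  LinearMap.trace k A ∘ₗ LinearMap.mulRight k (convolve f) ∘ₗ LinearMap.mul k A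

theorem traceForm_apply (f : A →ₗ[k] k) (b : A) :
    traceForm f b = LinearMap.trace k A (LinearMap.mul k A b * convolve f) := rfl

variable [FiniteDimensional k A]

/-- The `A`-linear trace of `z (id ⊗ T)` on `A ⊗ A` is obtained from `z` by applying
`b ↦ tr (b T)` to the second tensor factor. -/
theorem trace_mul_baseChange (T : A →ₗ[k] A) (z : A ⊗[k] A) :
    LinearMap.trace A (A ⊗[k] A) (LinearMap.mul A (A ⊗[k] A) z * T.baseChange A) =
      leftSlice (LinearMap.trace k A ∘ₗ LinearMap.mulRight k T ∘ₗ LinearMap.mul k A) z := by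
  induction z using TensorProduct.induction_on with
  | zero => simp
  | tmul a x =>
    have h : LinearMap.mul A (A ⊗[k] A) (a ⊗ₜ x) * T.baseChange A =
        a • (LinearMap.mul k A x * T).baseChange A := by
      ext y
      simp [TensorProduct.smul_tmul']
    rw [h, map_smul, LinearMap.trace_baseChange, leftSlice_tmul, smul_eq_mul, mul_comm,
      ← Algebra.smul_def]
    rfl
  | add y z hy hz => simp only [map_add, add_mul, hy, hz]

/-- Let `T x = x₁ f(x₂)`. Conjugation by the left Galois map turns multiplication by `1 ⊗ b` into
multiplication by `Δ b` and fixes the base change of `T`, so comparing `A`-linear traces gives `b₁ tr(b₂ T) = tr(b T) 1`. -/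
theorem isLeftIntegral_traceForm (f : A →ₗ[k] k) : IsLeftIntegral (traceForm f) := by
  intro b
  have hinj : Function.Injective (leftGalois k A) :=
    OrzechProperty.injective_of_surjective_endomorphism (leftGalois k A).toLinearMap
      leftGalois_surjective
  let W : A ⊗[k] A ≃ₗ[A] A ⊗[k] A :=
    LinearEquiv.ofBijective (leftGalois k A).toLinearMap ⟨hinj, leftGalois_surjective⟩
  have hW : ∀ z, W z = leftGalois k A z := fun _ => rfl
  change leftSlice (traceForm f) (comul b) = _
  have key : W.conj (LinearMap.mul A (A ⊗[k] A) (1 ⊗ₜ b) * (convolve f).baseChange A) =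
      LinearMap.mul A (A ⊗[k] A) (comul b) * (convolve f).baseChange A := by
    apply LinearMap.ext
    intro z
    obtain ⟨z, rfl⟩ := W.surjective z
    rw [LinearEquiv.conj_apply_apply, LinearEquiv.symm_apply_apply]
    simp only [Module.End.mul_apply, LinearMap.mul_apply_apply, hW, map_mul]
    rw [leftGalois_baseChange_convolve, leftGalois_tmul, ← Algebra.TensorProduct.one_def, one_mul]
  rw [traceForm, ← trace_mul_baseChange, ← key, LinearMap.trace_conj', trace_mul_baseChange,
    leftSlice_tmul]

/-- For a basis `e` with dual basis `e'`, the sum over `i` of the values of `traceForm (e' i)` at `S(e i)`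
is the trace of `x ↦ x₁ S(x₂) = ε(x) 1`, which is `1`; so these integrals are not all zero. -/
theorem exists_isLeftIntegral_ne_zero : ∃ l : A →ₗ[k] k, IsLeftIntegral l ∧ l ≠ 0 := by
  by_contra! H
  let e := Module.finBasis k A
  have hz : ∀ z : A ⊗[k] A, ∑ i, antipode k (e i) * leftSlice (e.coord i) z =
      LinearMap.mul' k A ((antipode k).lTensor A z) := by
    intro z
    induction z using TensorProduct.induction_on with
    | zero => simp
    | tmul a b =>
      conv_rhs => rw [← e.sum_repr b]
      simp [Finset.mul_sum, mul_comm, -Module.Basis.sum_repr]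
    | add y z hy hz => simp only [map_add, mul_add, Finset.sum_add_distrib, hy, hz]
  have hT : ∑ i, LinearMap.mul k A (antipode k (e i)) * convolve (e.coord i) =
      (counit (R := k) (A := A)).smulRight (1 : A) := by
    apply LinearMap.ext
    intro x
    rw [LinearMap.sum_apply]
    refine (hz (comul x)).trans ?_
    rw [mul_antipode_lTensor_comul_apply, Algebra.algebraMap_eq_smul_one]
    rfl
  have h1 := congrArg (LinearMap.trace k A) hT
  rw [LinearMap.trace_smulRight, Bialgebra.counit_one, map_sum] at h1
  simp only [← traceForm_apply, H _ (isLeftIntegral_traceForm _), LinearMap.zero_apply,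
    Finset.sum_const_zero, zero_ne_one] at h1

/-- A nonzero left integral is a Frobenius form on `A`: its radical contains the right tensor factors
of `Δ a` along with `a`, lies in the kernel of the counit, and hence is zero. -/
theorem eq_zero_of_forall_mul_eq_zero {l : A →ₗ[k] k} (hl : IsLeftIntegral l) (hl0 : l ≠ 0)
    {a : A} (ha : ∀ x, l (a * x) = 0) : a = 0 := by
  let e := Module.finBasis k A
  have hrepr : ∀ {a : A}, (∀ x, l (a * x) = 0) → ∃ r : Fin _ → A,
      comul a = ∑ i, e i ⊗ₜ[k] r i ∧ ∀ i x, l (r i * x) = 0 := by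
    intro a ha
    obtain ⟨r, hr⟩ := exists_repr_basis e (comul a)
    refine ⟨r, hr, fun i x => ?_⟩
    have h0 : leftSlice l ((1 ⊗ₜ a) * comul x) = 0 := by
      induction comul (R := k) x using TensorProduct.induction_on with
      | zero => simp
      | tmul b c => simp [ha]
      | add y z hy hz => simp only [mul_add, map_add, hy, hz, add_zero]
    rw [leftSlice_one_tmul_mul_comul hl, hr] at h0
    -- The antipode turns `S(a₁) l(a₂ x) = 0` into `a₁ l(a₂ x) = 0`, which can be read off
    -- coordinatewise in the basis `e`.
    have h1 := congrArg (antipode k) h0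
    simp only [map_sum, LinearMap.rTensor_tmul, Finset.sum_mul,
      Algebra.TensorProduct.tmul_mul_tmul, mul_one, leftSlice_tmul, map_smul, antipode_antipode,
      map_zero] at h1
    exact Fintype.linearIndependent_iff.1 e.linearIndependent _ h1 i
  have hcounit : ∀ {a : A}, (∀ x, l (a * x) = 0) → counit (R := k) a = 0 := by
    intro a ha
    obtain ⟨r, hr, h⟩ := hrepr ha
    have h1 := mul_antipode_rTensor_comul_apply (R := k) a
    rw [hr] at h1
    simp only [map_sum, LinearMap.rTensor_tmul, LinearMap.mul'_apply] at h1
    -- If `ε(a) ≠ 0`, then `ε(a) = S(a₁) a₂` forces `l = 0`, as every `a₂` is in the radical of `l`.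
    by_contra hc
    apply hl0
    ext y
    have h2 := congrArg (fun z => l (z * y)) h1
    simp only [Finset.sum_mul, map_sum, mul_comm (antipode k _), mul_assoc, h,
      Finset.sum_const_zero, ← Algebra.smul_def, map_smul, smul_eq_mul] at h2
    exact (mul_eq_zero.1 h2.symm).resolve_left hc
  obtain ⟨r, hr, h⟩ := hrepr ha
  have h1 := lTensor_counit_comul (R := k) a
  rw [hr] at h1
  have h2 := congrArg (TensorProduct.rid k A) h1
  simpa [hcounit (h _)] using h2.symm

variable (k A) in
/-- There are a left integral `l` and `t : A` with `l (x t) = ε(x)`; the latter says that `t` is an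
integral in `A`, normalized by `l t = 1`. -/
theorem exists_integral_pair : ∃ (l : A →ₗ[k] k) (t : A), IsLeftIntegral l ∧
    (∀ f : A →ₗ[k] k, ∃ a, ∀ x, f x = l (a * x)) ∧ ∀ x, l (x * t) = counit (R := k) x := by
  obtain ⟨l, hl, hl0⟩ := exists_isLeftIntegral_ne_zero (k := k) (A := A)
  have hinj : Function.Injective (l.compRight k ∘ₗ LinearMap.mul k A) := by
    rw [← LinearMap.ker_eq_bot, LinearMap.ker_eq_bot']
    intro a ha
    exact eq_zero_of_forall_mul_eq_zero hl hl0 fun x => LinearMap.congr_fun ha x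
  have hsurj : ∀ f : A →ₗ[k] k, ∃ a, ∀ x, f x = l (a * x) := by
    intro f
    obtain ⟨a, ha⟩ := (LinearMap.injective_iff_surjective_of_finrank_eq_finrank
      (Subspace.dual_finrank_eq (K := k) (V := A)).symm).1 hinj f
    exact ⟨a, fun x => (LinearMap.congr_fun ha x).symm⟩
  obtain ⟨t, ht⟩ := hsurj counit
  exact ⟨l, t, hl, hsurj, fun x => by rw [ht, mul_comm]⟩

/-- The pairing `(f, h) ↦ (f * h)(t)` on the group algebra is nondegenerate. -/
theorem leftSlice_comul_integral_bijective {l : A →ₗ[k] k} (hl : IsLeftIntegral l) {t : A}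
    (ht : ∀ x, l (x * t) = counit (R := k) x) :
    Function.Bijective fun f : A →ₗ[k] k => leftSlice f (comul t) := by
  let F : (A →ₗ[k] k) →ₗ[k] A :=
    { toFun := fun f => leftSlice f (comul t)
      map_add' := fun f g => by
        simp only [leftSlice, LinearMap.lTensor_add, LinearMap.comp_add, LinearMap.add_apply]
      map_smul' := fun c f => by
        simp only [leftSlice, LinearMap.lTensor_smul, LinearMap.comp_smul, LinearMap.smul_apply,
          RingHom.id_apply] }
  have hF : Function.Surjective F := by
    intro a
    refine ⟨l ∘ₗ LinearMap.mul k A (antipode k a), ?_⟩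
    change leftSlice _ (comul t) = a
    rw [← leftSlice_one_tmul_mul, leftSlice_one_tmul_mul_comul_integral hl ht, antipode_antipode]
  exact ⟨(LinearMap.injective_iff_surjective_of_finrank_eq_finrank
    (Subspace.dual_finrank_eq (K := k) (V := A))).2 hF, hF⟩

/-- Left integrals are unique up to a scalar. -/
theorem IsLeftIntegral.eq_smul {l l' : A →ₗ[k] k} (hl : IsLeftIntegral l)
    (hl' : IsLeftIntegral l') {t : A} (ht : ∀ x, l (x * t) = counit (R := k) x) :
    l' = l' t • l := by
  apply (leftSlice_comul_integral_bijective hl ht).1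
  have hlt : l t = 1 := by simpa using ht 1
  have h1 : leftSlice (l' t • l) (comul t) = l' t • leftSlice l (comul t) := by
    simp only [leftSlice, LinearMap.lTensor_smul, LinearMap.comp_smul, LinearMap.smul_apply]
  change convolve l' t = leftSlice (l' t • l) (comul t)
  rw [h1, hl']
  change _ = l' t • convolve l t
  rw [hl, hlt, one_smul]

/-! ### The modular element -/

/-- The element `g = l(t₁) t₂` is the modular element: `l(x₁) x₂ = l(x) g` for all `x`.
Indeed `l * f` is again a left integral, so it is a multiple of `l`. -/
theorem rightSlice_comul {l : A →ₗ[k] k} (hl : IsLeftIntegral l) {t : A}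
    (ht : ∀ x, l (x * t) = counit (R := k) x) (x : A) :
    rightSlice l (comul x) = l x • rightSlice l (comul t) := by
  rw [← sub_eq_zero, ← Module.forall_dual_apply_eq_zero_iff k]
  intro f
  have h1 := LinearMap.congr_fun (hl.eq_smul (hl.convMul (WithConv.toConv f)) ht) x
  rw [LinearMap.smul_apply, convMul_apply_rightSlice, convMul_apply_rightSlice] at h1
  rw [map_sub, sub_eq_zero, map_smul]
  exact h1.trans (mul_comm _ _)

/-- The modular element is group-like: evaluation at it is multiplicative on the group algebra. -/
theorem convMul_apply_modular {l : A →ₗ[k] k} (hl : IsLeftIntegral l) {t : A}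
    (ht : ∀ x, l (x * t) = counit (R := k) x) (f h : GroupAlg k A) :
    (f * h).ofConv (rightSlice l (comul t)) =
      f.ofConv (rightSlice l (comul t)) * h.ofConv (rightSlice l (comul t)) := by
  have hf : WithConv.toConv l * f = f.ofConv (rightSlice l (comul t)) • WithConv.toConv l := by
    ext x
    rw [convMul_apply_rightSlice]
    change f.ofConv (rightSlice l (comul x)) = _ * l x
    rw [rightSlice_comul hl ht x, map_smul, smul_eq_mul, mul_comm]
  rw [← convMul_apply_rightSlice (WithConv.toConv l), ← mul_assoc, hf, smul_mul_assoc]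
  change _ * (WithConv.toConv l * h).ofConv t = _
  rw [convMul_apply_rightSlice]

theorem rightSlice_rightGalois {l : A →ₗ[k] k} (hl : IsLeftIntegral l) {t : A}
    (ht : ∀ x, l (x * t) = counit (R := k) x) (z : A ⊗[k] A) :
    rightSlice l (rightGalois k A z) = rightSlice l (comul t) * rightSlice l z := by
  induction z using TensorProduct.induction_on with
  | zero => simp
  | tmul x a =>
    rw [rightGalois_tmul, rightSlice_mul_one_tmul, rightSlice_tmul, rightSlice_comul hl ht x]
    simp
  | add y z hy hz => simp only [map_add, mul_add, hy, hz]

/-- In Sweedler notation, with `g = l(t₁) t₂`: `l(a t₁) t₂ = g S(a)`. -/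
theorem rightSlice_tmul_one_mul_comul_integral {l : A →ₗ[k] k} (hl : IsLeftIntegral l) {t : A}
    (ht : ∀ x, l (x * t) = counit (R := k) x) (a : A) :
    rightSlice l ((a ⊗ₜ 1) * comul t) = rightSlice l (comul t) * antipode k a := by
  have h : ∀ z : A ⊗[k] A, rightSlice l (z * (t ⊗ₜ 1)) = rightSlice counit z := by
    intro z
    induction z using TensorProduct.induction_on with
    | zero => simp
    | tmul b c => simp [ht]
    | add y z hy hz => simp only [map_add, add_mul, hy, hz]
  have h2 : rightGalois k A (t ⊗ₜ 1) = comul t := by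
    rw [rightGalois_tmul, ← Algebra.TensorProduct.one_def, mul_one]
  rw [← h2, ← rightGalois_lTensor_antipode_comul, ← map_mul (rightGalois k A),
    rightSlice_rightGalois hl ht, h, h2, rightSlice_lTensor, rightSlice_counit_comul]

end Hopf

/-! ### The Frobenius form of the group algebra and unipotent subgroup schemes -/

section Unipotent

open HopfAlgebra Coalgebra

/-- A unipotent group scheme has no nontrivial character, as a character is a one-dimensional module. -/
theorem IsUnipotent.eq_one {k : Type u} {B : Type v} [Field k] [CommRing B] [HopfAlgebra k B]
    (hB : IsUnipotent k B) {g : B}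
    (hg : ∀ f h : GroupAlg k B, (f * h).ofConv g = f.ofConv g * h.ofConv g)
    (hg1 : counit (R := k) g = 1) : g = 1 := by
  let χ : GroupAlg k B →+* k :=
    { toFun := fun f => f.ofConv g
      map_one' := hg1
      map_mul' := hg
      map_zero' := rfl
      map_add' := fun _ _ => rfl }
  -- The fixed vectors of `k`, with `f` acting by `f(g)`, are killed by all `f(g) - f(1)`.
  let _ : Module (GroupAlg k B) k := Module.compHom k χ
  obtain ⟨x, hx, h⟩ := hB k
  rw [← sub_eq_zero, ← Module.forall_dual_apply_eq_zero_iff k]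
  intro f
  have h1 : f g * x = (algebraMap k (GroupAlg k B) (f 1)).ofConv g * x := h (WithConv.toConv f)
  have h2 : (algebraMap k (GroupAlg k B) (f 1)).ofConv g = f 1 * counit (R := k) g := by
    rw [Algebra.algebraMap_eq_smul_one]; rfl
  rw [h2, hg1, mul_one] at h1
  rw [map_sub, sub_eq_zero]
  exact mul_right_cancel₀ hx h1

/-- Evaluation at a suitable `t` is a Frobenius form on the group algebra of a finite group scheme. Its
Nakayama automorphism is the twist by the modular character, so it fixes the group algebra of every
unipotent subgroup scheme. -/
theorem exists_frobeniusForm (k : Type u) (A : Type v) [Field k] [CommRing A] [HopfAlgebra k A]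
    [FiniteDimensional k A] : ∃ t : A,
    (∀ θ : GroupAlg k A →ₗ[k] k, ∃! h : GroupAlg k A, ∀ f, (f * h).ofConv t = θ f) ∧
    ∀ {B : Type v} [CommRing B] [HopfAlgebra k B], IsUnipotent k B → ∀ (φ : A →ₐc[k] B)
      (f : GroupAlg k B) (h : GroupAlg k A),
      (GroupAlg.map φ f * h).ofConv t = (h * GroupAlg.map φ f).ofConv t := by
  obtain ⟨l, t, hl, hsurj, ht⟩ := exists_integral_pair k A
  refine ⟨t, fun θ => ?_, fun {B} _ _ hB φ f h => ?_⟩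
  · let θ' : Module.Dual k (Module.Dual k A) :=
      θ ∘ₗ (WithConv.linearEquiv k (A →ₗ[k] k)).symm.toLinearMap
    obtain ⟨y, hy⟩ := (Module.bijective_dual_eval k A).2 θ'
    obtain ⟨h, hh : leftSlice h (comul t) = y⟩ := (leftSlice_comul_integral_bijective hl ht).2 y
    have hθ : ∀ f : GroupAlg k A, θ f = f.ofConv y := fun f =>
      (LinearMap.congr_fun hy f.ofConv).symm
    refine ⟨WithConv.toConv h, fun f => ?_, fun h' hh' => ?_⟩
    · rw [convMul_apply_leftSlice, hh, hθ]
    · apply WithConv.ofConv_injective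
      apply (leftSlice_comul_integral_bijective hl ht).1
      change leftSlice _ _ = leftSlice h _
      rw [hh, ← sub_eq_zero, ← Module.forall_dual_apply_eq_zero_iff k]
      intro f
      rw [map_sub, sub_eq_zero]
      have := hh' (WithConv.toConv f)
      rwa [convMul_apply_leftSlice, hθ] at this
  · -- With `h = l (a ·)`, the two sides are `f(φ(S a))` and `f(φ(g S(a)))`, and `φ(g) = 1`.
    obtain ⟨a, ha⟩ := hsurj h.ofConv
    have hh : h.ofConv = l ∘ₗ LinearMap.mul k A a := LinearMap.ext ha
    have hφ : φ (rightSlice l (comul t)) = 1 := by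
      apply hB.eq_one
      · intro f₁ f₂
        have := convMul_apply_modular hl ht (GroupAlg.map φ f₁) (GroupAlg.map φ f₂)
        rwa [← map_mul (GroupAlg.map φ)] at this
      · rw [CoalgHomClass.counit_comp_apply, counit_modular ht]
    rw [convMul_apply_leftSlice, convMul_apply_rightSlice, hh, ← leftSlice_one_tmul_mul,
      ← rightSlice_tmul_one_mul, leftSlice_one_tmul_mul_comul_integral hl ht,
      rightSlice_tmul_one_mul_comul_integral hl ht]
    change f.ofConv (φ _) = f.ofConv (φ (_ * _))
    rw [map_mul, hφ, one_mul]

end Unipotent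

/-! ### Induction and coinduction along Frobenius extensions -/

section Frobenius

variable {R : Type u} {S : Type v} [CommRing R] [Ring S] (f : R →+* S)

/-- The identity of `S`, as an additive equivalence onto the bimodule `RightVia f`. -/
def toRightVia : S ≃+ RightVia f := AddEquiv.refl S

/-- The pure tensor `s ⊗ m` in `S ⊗_R M`. -/
def inducedTmul {M : ModuleCat.{w} R} (s : S) (m : M) : (tensorAlong f).obj M :=
  (toRightVia f s ⊗ₜ[R] m : RightVia f ⊗[R] M)

theorem inducedTmul_add {M : ModuleCat.{w} R} (s : S) (m n : M) :
    inducedTmul f s (m + n) = inducedTmul f s m + inducedTmul f s n :=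
  TensorProduct.tmul_add _ _ _

theorem inducedTmul_zero {M : ModuleCat.{w} R} (s : S) : inducedTmul f s (0 : M) = 0 :=
  TensorProduct.tmul_zero _ _

theorem sum_inducedTmul {M : ModuleCat.{w} R} {ι : Type*} [Fintype ι] (s : ι → S) (m : M) :
    ∑ i, inducedTmul f (s i) m = inducedTmul f (∑ i, s i) m :=
  (TensorProduct.sum_tmul Finset.univ (fun i => toRightVia f (s i)) m).symm

theorem inducedTmul_smul {M : ModuleCat.{w} R} (s : S) (r : R) (m : M) :
    inducedTmul f s (r • m) = inducedTmul f (s * f r) m :=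
  (TensorProduct.smul_tmul r (toRightVia f s) m).symm

theorem inducedTmul_induction {M : ModuleCat.{w} R} {P : (tensorAlong f).obj M → Prop} (zero : P 0)
    (tmul : ∀ (s : S) (m : M), P (inducedTmul f s m))
    (add : ∀ x y, P x → P y → P (x + y)) (x : (tensorAlong f).obj M) : P x :=
  TensorProduct.induction_on (motive := P) x zero (fun s m => tmul ((toRightVia f).symm s) m)
    (fun x y => add x y)

/-- An additive map `S → M` that is `R`-linear for left multiplication through `f`, as an element of the
coinduced module. -/
def coextendMk {M : ModuleCat.{w} R} (F : S →+ M) (hF : ∀ r s, F (f r * s) = r • F s) :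
    (ModuleCat.coextendScalars f).obj M :=
  (ModuleCat.CoextendScalars.equiv f M).symm
    { toFun := F
      map_add' := F.map_add
      map_smul' := hF }

/-- Evaluation of the elements of the coinduced module at `s : S`. -/
def coextendEval (M : ModuleCat.{w} R) (s : S) : (ModuleCat.coextendScalars f).obj M →+ M :=
  AddMonoidHom.mk' (fun F => F s) fun _ _ => rfl

theorem coextend_ext {M : ModuleCat.{w} R} {F G : (ModuleCat.coextendScalars f).obj M}
    (h : ∀ s : S, coextendEval f M s F = coextendEval f M s G) : F = G :=
  ModuleCat.CoextendScalars.ext (LinearMap.ext h)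

theorem coextendEval_sum {M : ModuleCat.{w} R} (F : (ModuleCat.coextendScalars f).obj M)
    {ι : Type*} [Fintype ι] (r : ι → R) (x : ι → S) :
    coextendEval f M (∑ i, f (r i) * x i) F = ∑ i, r i • coextendEval f M (x i) F := by
  let F' := ModuleCat.CoextendScalars.equiv f M F
  exact (map_sum F' _ _).trans (Finset.sum_congr rfl fun i _ => F'.map_smul (r i) (x i))

variable (E : S →+ R)

/-- The `S`-linear map `S ⊗_R M → Hom_R(S, M)`, `s ⊗ m ↦ (x ↦ E(x s) m)`, for an `R`-bilinear
`E : S → R`. -/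
def frobeniusMap (hl : ∀ r s, E (f r * s) = r * E s) (hr : ∀ r s, E (s * f r) = r * E s)
    (M : ModuleCat.{w} R) :
    (tensorAlong f).obj M →ₗ[S] (ModuleCat.coextendScalars f).obj M :=
  let B (s : S) (m : M) : (ModuleCat.coextendScalars f).obj M :=
    coextendMk f (AddMonoidHom.mk' (fun x => E (x * s) • m) fun x y => by
      rw [add_mul, map_add, add_smul]) fun r x => by
        change E (f r * x * s) • m = r • E (x * s) • m
        rw [mul_assoc, hl, mul_smul]
  let Φ : RightVia f →+ M →+ (ModuleCat.coextendScalars f).obj M :=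
    (AddMonoidHom.mk' (fun s => AddMonoidHom.mk' (B s) fun m n =>
        coextend_ext f fun x => smul_add (E (x * s)) m n)
      fun s s' => AddMonoidHom.ext fun m => coextend_ext f fun x => by
        change E (x * (s + s')) • m = E (x * s) • m + E (x * s') • m
        rw [mul_add, map_add, add_smul]).comp (toRightVia f).symm.toAddMonoidHom
  let Ψ : RightVia f ⊗[R] M →+ (ModuleCat.coextendScalars f).obj M :=
    TensorProduct.liftAddHom Φ fun r s m => coextend_ext f fun x => by
      obtain ⟨s, rfl⟩ := (toRightVia f).surjective s
      change E (x * (s * f r)) • m = E (x * s) • r • m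
      rw [← mul_assoc, hr, mul_comm, mul_smul]
  { toFun := Ψ
    map_add' := map_add Ψ
    map_smul' := fun s y => by
      induction y using inducedTmul_induction with
      | zero => rw [smul_zero]; exact (map_zero Ψ).trans (smul_zero _).symm
      | tmul a m =>
        refine coextend_ext f fun x => ?_
        change E (x * (s * a)) • m = E (x * s * a) • m
        rw [mul_assoc]
      | add y z hy hz =>
        rw [smul_add]
        refine (map_add Ψ _ _).trans ?_
        rw [hy, hz, ← smul_add]
        exact congrArg _ (map_add Ψ _ _).symm }

theorem coextendEval_frobeniusMap_tmul (hl : ∀ r s, E (f r * s) = r * E s)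
    (hr : ∀ r s, E (s * f r) = r * E s) (M : ModuleCat.{w} R) (s : S) (m : M) (x : S) :
    coextendEval f M x (frobeniusMap f E hl hr M (inducedTmul f s m)) = E (x * s) • m := rfl

/-- If `x` and `a` are dual bases for the pairing `(s, s') ↦ E(s s')`, the inverse of `frobeniusMap` is
`F ↦ ∑ i, a i ⊗ F (x i)`. -/
theorem frobeniusMap_bijective (hl : ∀ r s, E (f r * s) = r * E s)
    (hr : ∀ r s, E (s * f r) = r * E s) {ι : Type*} [Fintype ι] (x a : ι → S)
    (h₁ : ∀ s, ∑ i, f (E (s * a i)) * x i = s) (h₂ : ∀ s, ∑ i, a i * f (E (x i * s)) = s)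
    (M : ModuleCat.{w} R) : Function.Bijective (frobeniusMap f E hl hr M) := by
  let inv (F : (ModuleCat.coextendScalars f).obj M) : (tensorAlong f).obj M :=
    ∑ i, inducedTmul f (a i) (coextendEval f M (x i) F)
  refine Function.bijective_iff_has_inverse.2 ⟨inv, fun y => ?_, fun F => ?_⟩
  · induction y using inducedTmul_induction with
    | zero =>
      simp only [inv, map_zero, inducedTmul_zero, Finset.sum_const_zero]
    | tmul s m =>
      simp only [inv, coextendEval_frobeniusMap_tmul, inducedTmul_smul, sum_inducedTmul, h₂]
    | add y z hy hz =>
      have h : ∀ F G, inv (F + G) = inv F + inv G := fun F G => by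
        simp only [inv, map_add, inducedTmul_add, Finset.sum_add_distrib]
      rw [map_add, h, hy, hz]
  · refine coextend_ext f fun s => ?_
    simp only [inv, map_sum, coextendEval_frobeniusMap_tmul]
    rw [← coextendEval_sum, h₁]

theorem nonempty_tensorAlong_iso_coextendScalars (hl : ∀ r s, E (f r * s) = r * E s)
    (hr : ∀ r s, E (s * f r) = r * E s) {ι : Type*} [Fintype ι] (x a : ι → S)
    (h₁ : ∀ s, ∑ i, f (E (s * a i)) * x i = s) (h₂ : ∀ s, ∑ i, a i * f (E (x i * s)) = s) :
    Nonempty (tensorAlong.{u, v, w} f ≅ ModuleCat.coextendScalars.{u, v, w} f) := by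
  refine ⟨NatIso.ofComponents (fun M => (LinearEquiv.ofBijective _
    (frobeniusMap_bijective f E hl hr x a h₁ h₂ M)).toModuleIso) fun {M N} g => ?_⟩
  apply ModuleCat.hom_ext
  apply LinearMap.ext
  intro y
  induction y using inducedTmul_induction with
  | zero => rw [map_zero, map_zero]
  | tmul b m =>
    refine coextend_ext f fun s => ?_
    exact (g.hom.map_smul (E (s * b)) m).symm
  | add y z hy hz => rw [map_add, map_add, hy, hz]

end Frobenius

/-! ### The truncated polynomial algebra -/

/-- The coefficient of `t^(p-1)` is a Frobenius form on `k[t]/(t^p)`. -/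
theorem exists_truncPoly_form (k : Type u) [Field k] {p : ℕ} (hp : 0 < p) :
    ∃ σ : TruncPoly k p →ₗ[k] k, ∀ θ : TruncPoly k p →ₗ[k] k,
      ∃! r, ∀ s, σ (s * r) = θ s := by
  have hfin : Module.Finite k (TruncPoly k p) :=
    (Polynomial.monic_X_pow p).finite_quotient
  let σ : TruncPoly k p →ₗ[k] k :=
    Submodule.liftQ ((Ideal.span {(Polynomial.X : Polynomial k) ^ p}).restrictScalars k)
      (Polynomial.lcoeff k (p - 1)) fun P hP => by
        obtain ⟨Q, rfl⟩ := Ideal.mem_span_singleton.1 hP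
        have : p - 1 < p := by omega
        simp [Polynomial.coeff_X_pow_mul', this]
  have hσ : ∀ P : Polynomial k, σ (Ideal.Quotient.mk _ P) = P.coeff (p - 1) := fun _ => rfl
  have hinj : Function.Injective (LinearMap.mul k (TruncPoly k p) |>.flip.compr₂ σ) := by
    rw [← LinearMap.ker_eq_bot, LinearMap.ker_eq_bot']
    intro r hr
    obtain ⟨P, rfl⟩ := Ideal.Quotient.mk_surjective r
    rw [Ideal.Quotient.eq_zero_iff_mem, Ideal.mem_span_singleton, Polynomial.X_pow_dvd_iff]
    intro d hd
    -- Multiplying by `X ^ (p - 1 - d)` moves the coefficient of degree `d` to degree `p - 1`.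
    have h : σ (Ideal.Quotient.mk _ (Polynomial.X ^ (p - 1 - d) * P)) = 0 := by
      rw [map_mul]
      exact LinearMap.congr_fun hr (Ideal.Quotient.mk _ (Polynomial.X ^ (p - 1 - d)))
    rw [hσ, Polynomial.coeff_X_pow_mul', if_pos (by omega)] at h
    rwa [show p - 1 - (p - 1 - d) = d by omega] at h
  have hsurj := (LinearMap.injective_iff_surjective_of_finrank_eq_finrank
    (Subspace.dual_finrank_eq (K := k) (V := TruncPoly k p)).symm).1 hinj
  refine ⟨σ, fun θ => ?_⟩
  obtain ⟨r, hr⟩ := hsurj θ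
  exact ⟨r, fun s => LinearMap.congr_fun hr s, fun r' hr' =>
    hinj ((LinearMap.ext hr').trans hr.symm)⟩

/-! ### Induction and coinduction for Frobenius algebras -/

theorem finite_restrictScalars {k : Type*} {R : Type u} {S : Type v} [CommRing k] [CommRing R]
    [Algebra k R] [Ring S] [Algebra k S] [hS : Module.Finite k S] (α : R →ₐ[k] S) :
    Module.Finite R ((ModuleCat.restrictScalars (α : R →+* S)).obj (ModuleCat.of S S)) := by
  let N := (ModuleCat.restrictScalars (α : R →+* S)).obj (ModuleCat.of S S)
  let _ : Module k N := (Algebra.toModule : Module k S)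
  have _ : Module.Finite k N := hS
  have _ : IsScalarTower k R N := ⟨fun c r (x : S) => by
    change α (c • r) * x = c • (α r * x)
    rw [map_smul, smul_mul_assoc]⟩
  exact Module.Finite.of_restrictScalars_finite k R N

/-- If `R` and `S` have Frobenius forms `σ` and `τ`, and `τ` commutes with the image of `α`, then
`σ (r E(s)) = τ (α(r) s)` defines an `R`-bilinear `E : S → R`, through which every `R`-linear form on
`S` is `s ↦ E(s a)` for some `a`. A dual basis of the projective module `S` then yields dual bases for `E`. -/
theorem nonempty_iso_of_frobeniusForms {k : Type*} {R : Type u} {S : Type v} [Field k] [CommRing R]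
    [Algebra k R] [Ring S] [Algebra k S] (α : R →ₐ[k] S) (σ : R →ₗ[k] k)
    (hσ : ∀ θ : R →ₗ[k] k, ∃! r, ∀ s, σ (s * r) = θ s)
    (τ : S →ₗ[k] k) (hτ : ∀ θ : S →ₗ[k] k, ∃! a, ∀ s, τ (s * a) = θ s)
    (hατ : ∀ r s, τ (α r * s) = τ (s * α r))
    [Module.Finite R ((ModuleCat.restrictScalars (α : R →+* S)).obj (ModuleCat.of S S))]
    [Module.Projective R ((ModuleCat.restrictScalars (α : R →+* S)).obj (ModuleCat.of S S))] :
    Nonempty (tensorAlong.{u, v, w} (α : R →+* S) ≅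
      ModuleCat.coextendScalars.{u, v, w} (α : R →+* S)) := by
  choose D hD hDu using hσ
  let E₀ (s : S) : R := D (τ ∘ₗ LinearMap.mulRight k s ∘ₗ α.toLinearMap)
  have hE₀ : ∀ s r, σ (r * E₀ s) = τ (α r * s) := fun s r => hD _ r
  have hE₀u : ∀ s x, (∀ r, σ (r * x) = τ (α r * s)) → x = E₀ s := fun s x h => hDu _ x h
  let E : S →+ R := AddMonoidHom.mk' E₀ fun s s' => (hE₀u _ _ fun r => by
    rw [mul_add, mul_add, map_add, map_add, hE₀, hE₀]).symm
  have hE : ∀ s r, σ (r * E s) = τ (α r * s) := hE₀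
  have hEu : ∀ s x, (∀ r, σ (r * x) = τ (α r * s)) → x = E s := hE₀u
  have hE1 : ∀ s, σ (E s) = τ s := fun s => by simpa using hE s 1
  have hl : ∀ r s, E (α r * s) = r * E s := fun r s => (hEu _ _ fun r' => by
    rw [← mul_assoc, hE, map_mul α, mul_assoc]).symm
  have hr : ∀ r s, E (s * α r) = r * E s := fun r s => (hEu _ _ fun r' => by
    rw [← mul_assoc, hE, mul_comm r' r, map_mul α, mul_assoc, hατ, mul_assoc]).symm
  -- A finite dual basis `x`, `c` of the projective left `R`-module `S`.
  obtain ⟨n, P, g, -, -, hPg⟩ := Module.Finite.exists_comp_eq_id_of_projective R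
    ((ModuleCat.restrictScalars (α : R →+* S)).obj (ModuleCat.of S S))
  let x (i : Fin n) : S := P (Pi.single i 1)
  let c (i : Fin n) (s : S) : R := g s i
  have hc : ∀ i r s, c i (α r * s) = r * c i s := fun i r s => congrFun (g.map_smul r s) i
  have hcadd : ∀ i s s', c i (s + s') = c i s + c i s' := fun i s s' => congrFun (g.map_add s s') i
  have hx : ∀ s : S, ∑ i, α (c i s) * x i = s := by
    intro s
    have h1 : g s = ∑ i, c i s • (Pi.single i 1 : Fin n → R) := pi_eq_sum_univ' (g s)
    have h2 : P (g s) = s := LinearMap.congr_fun hPg s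
    rw [h1] at h2
    exact ((map_sum P _ _).trans (Finset.sum_congr rfl fun i _ => P.map_smul _ _)).symm.trans h2
  have hrepr : ∀ i, ∃ a : S, ∀ s, E (s * a) = c i s := by
    intro i
    -- The `k`-linear form `σ ∘ c i` is `τ (· a)`, and nondegeneracy of `σ` lifts this to `c i = E (· a)`.
    let θ : S →ₗ[k] k :=
      { toFun := fun s => σ (c i s)
        map_add' := fun s s' => by rw [hcadd, map_add]
        map_smul' := fun b s => by
          have := hc i (algebraMap k R b) s
          rw [AlgHom.commutes, ← Algebra.smul_def, ← Algebra.smul_def] at this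
          rw [this, map_smul]; rfl }
    obtain ⟨a, ha, -⟩ := hτ θ
    refine ⟨a, fun s => (hEu _ _ fun r => ?_).symm⟩
    rw [← mul_assoc, ha, ← hc]; rfl
  choose a ha using hrepr
  refine nonempty_tensorAlong_iso_coextendScalars (α : R →+* S) E hl hr x a (fun s => ?_)
    fun s => ?_
  · simp only [ha]
    exact hx s
  · -- Both sides represent the form `z ↦ τ (z s)`, since `E (z s) = ∑ i, E (z (a i)) E ((x i) s)`.
    obtain ⟨y, -, hy⟩ := hτ (τ ∘ₗ LinearMap.mulRight k s)
    refine (hy _ fun z => ?_).trans (hy _ fun z => rfl).symm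
    change τ (z * _) = τ (z * s)
    conv_rhs => rw [← hx z, Finset.sum_mul, ← hE1, map_sum]
    rw [Finset.mul_sum, ← hE1, map_sum]
    congr 1
    refine Finset.sum_congr rfl fun i _ => ?_
    change E (z * (a i * α (E (x i * s)))) = _
    rw [← mul_assoc, hr, ha, mul_assoc, hl, mul_comm]

end PiPoint

end

theorem theorem3p1 (k : Type u) [Field k] (p : ℕ) [Fact p.Prime] [CharP k p]
    (A : Type v) [CommRing A] [HopfAlgebra k A] [FiniteDimensional k A]
    (α : PiPoint.TruncPoly k p →ₐ[k] PiPoint.GroupAlg k A) (hα : PiPoint.IsPiPoint α) :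
    Nonempty (PiPoint.tensorAlong.{u, max u v, w} (α : PiPoint.TruncPoly k p →+* PiPoint.GroupAlg k A) ≅
      ModuleCat.coextendScalars.{u, max u v, w}
        (α : PiPoint.TruncPoly k p →+* PiPoint.GroupAlg k A)) := by
  obtain ⟨σ, hσ⟩ := PiPoint.exists_truncPoly_form k (Fact.out : p.Prime).pos
  obtain ⟨t, ht, hcomm⟩ := PiPoint.exists_frobeniusForm k A
  obtain ⟨B, _, _, φ, β, -, -, hB, rfl⟩ := hα.factors
  have hflat := hα.flat
  generalize hα' : (PiPoint.GroupAlg.map φ).comp β = α at *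
  have hk : Module.Finite k (PiPoint.GroupAlg k A) :=
    Module.Finite.equiv (WithConv.linearEquiv k (A →ₗ[k] k)).symm
  have hN := PiPoint.finite_restrictScalars α
  have hfp := Module.finitePresentation_of_finite (PiPoint.TruncPoly k p)
    ((ModuleCat.restrictScalars (α : PiPoint.TruncPoly k p →+* PiPoint.GroupAlg k A)).obj
      (ModuleCat.of (PiPoint.GroupAlg k A) (PiPoint.GroupAlg k A)))
  have hproj := Module.Flat.projective_of_finitePresentation (R := PiPoint.TruncPoly k p)
    (M := (ModuleCat.restrictScalars (α : PiPoint.TruncPoly k p →+* PiPoint.GroupAlg k A)).obj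
      (ModuleCat.of (PiPoint.GroupAlg k A) (PiPoint.GroupAlg k A)))
  let τ : PiPoint.GroupAlg k A →ₗ[k] k :=
    { toFun := fun f => f.ofConv t
      map_add' := fun _ _ => rfl
      map_smul' := fun _ _ => rfl }
  refine PiPoint.nonempty_iso_of_frobeniusForms α σ hσ τ ht fun r s => ?_
  rw [← hα']
  exact hcomm hB φ (β r) s
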